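/- Consider a stochastic bandit with arms $1,\dots,K$. In slot $t=1,2,\dots$ the agent observes a load $L_t$, then pulls an arm $a_t$ chosen from $L_t$ and the history $(L_s,a_s,X_{a_s,s})_{s<t}$, observes the nominal reward $X_{a_t,t}$ and receives the actual reward $L_tX_{a_t,t}$. The rewards $X_{k,t}\in[0,1]$ are independent across arms and i.i.d. over time with mean $u_k$, and there is a unique best arm, with mean $u^*=\max_k u_k$. The loads $L_t$ are i.i.d., independent of the rewards, and binary: $L_t\in\{\varepsilon_0,1-\varepsilon_1\}$ with $\mathbb P(L_t=\varepsilon_0)=\rho\in(0,1)$, where $\varepsilon_0=0$ and $0\le\varepsilon_1<\frac{\sqrt2}{4}$. AdaUCB with parameter $\alpha$ pulls each arm once in the first $K$ slots. In each slot $t>K$ it pulls an arm $k$ that maximizes $$\hat u_k(t)=\bar u_k(t)+\sqrt{\frac{\alpha\,(1-\tilde L_t)\log t}{C_k(t-1)}},$$ where $C_k(t-1)$ is the number of pulls of arm $k$ before slot $t$, $\bar u_k(t)$ is the average of the rewards observed in these pulls, and $\tilde L_t=\frac{\max\{l^-,\min(L_t,l^+)\}-l^-}{l^+-l^-}$ is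 the normalized load with thresholds $l^-=\varepsilon_0=0$ and $l^+=1$. Ties are broken by any measurable rule based on $L_t$ and the history. If $\alpha>16$, then the expected regret $$R(T)=u^*\,\mathbb E\Big[\sum_{t=1}^T L_t\Big]-\sum_{t=1}^T\mathbb E[L_tX_{a_t,t}]$$ is $O(1)$ in $T$: there is a constant $C$, depending only on $K,\alpha,\varepsilon_1,\rho$ and $u_1,\dots,u_K$, such that $|R(T)|\le C$ for all $T\ge0$. -/

import Mathlib

open MeasureTheory ProbabilityTheory

noncomputable section

namespace OppBandit

/-- What the agent records in one slot: the load, the arm pulled, and the nominal reward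
of that arm. -/
abbrev Obs (K : ℕ) : Type := ℝ × Fin K × ℝ

/-- The history of the first `n` slots. Slots are numbered `1, 2, 3, …` in the usual notation;
here slot `t = n + 1` has index `n`, so it is preceded by exactly `n` recorded slots. -/
abbrev History (K n : ℕ) : Type := Fin n → Obs K

/-- A policy chooses the arm of slot `n + 1` from the load of this slot and the history of the
first `n` slots. -/
abbrev Policy (K : ℕ) : Type := (n : ℕ) → ℝ → History K n → Fin K

/-- Number of times arm `k` was pulled in the history `h`. -/
def pulls {K n : ℕ} (h : History K n) (k : Fin K) : ℕ :=
  (Finset.univ.filter fun i => (h i).2.1 = k).card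

/-- Empirical mean of the observed nominal rewards of arm `k` in the history `h`. -/
def empMean {K n : ℕ} (h : History K n) (k : Fin K) : ℝ :=
  (∑ i ∈ Finset.univ.filter (fun i => (h i).2.1 = k), (h i).2.2) / (pulls h k : ℝ)

/-- Load truncated to `[lo, hi]` and normalized to `[0, 1]`. -/
def normLoad (lo hi l : ℝ) : ℝ := (max lo (min l hi) - lo) / (hi - lo)

/-- The AdaUCB index of arm `k` in slot `t = n + 1`, when the load of this slot is `l` and the
history of the first `n` slots is `h`. -/
def adaIndex {K n : ℕ} (α lo hi l : ℝ) (h : History K n) (k : Fin K) : ℝ :=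
  empMean h k +
    √(α * (1 - normLoad lo hi l) * Real.log ((n : ℝ) + 1) / (pulls h k : ℝ))

/-- `Γ` is an AdaUCB policy with exploration parameter `α` and truncation thresholds `lo`, `hi`:
each arm is pulled once in the first `K` slots (in any order), and in every later slot an arm with
the largest index is pulled (ties may be broken by any measurable rule). -/
structure IsAdaUCB {K : ℕ} (α lo hi : ℝ) (Γ : Policy K) : Prop where
  measurable : ∀ n : ℕ, Measurable fun p : ℝ × History K n => Γ n p.1 p.2
  init : ∀ n : ℕ, n < K → ∀ (l : ℝ) (h : History K n), pulls h (Γ n l h) = 0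
  argmax : ∀ n : ℕ, K ≤ n → ∀ (l : ℝ) (h : History K n) (k : Fin K),
    adaIndex α lo hi l h k ≤ adaIndex α lo hi l h (Γ n l h)

/-- The history of the first `n` slots produced by the policy `Γ` along the load sequence `l` and
the nominal rewards `x`. -/
def history {K : ℕ} (Γ : Policy K) (l : ℕ → ℝ) (x : Fin K → ℕ → ℝ) : (n : ℕ) → History K n
  | 0 => Fin.elim0
  | n + 1 =>
    let h := history Γ l x n
    let a := Γ n (l n) h
    Fin.snoc (α := fun _ => Obs K) h (l n, a, x a n)

/-- The arm pulled by `Γ` in slot `n + 1`. -/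
def action {K : ℕ} (Γ : Policy K) (l : ℕ → ℝ) (x : Fin K → ℕ → ℝ) (n : ℕ) : Fin K :=
  Γ n (l n) (history Γ l x n)

/-- The opportunistic bandit with i.i.d. random binary load and random rewards: the loads `L n` are
i.i.d. with values in `{ε₀, 1 - ε₁}` and `ℙ(L n = ε₀) = ρ`; the nominal rewards `X k n` lie in
`[0, 1]`, are independent across arms and i.i.d. over time with mean `u k`; and the rewards are
independent of the loads. -/
structure IsRandomBinaryBandit {K : ℕ} {Ω : Type*} [MeasurableSpace Ω] (P : Measure Ω)
    (ε₀ ε₁ ρ : ℝ) (u : Fin K → ℝ) (L : ℕ → Ω → ℝ) (X : Fin K → ℕ → Ω → ℝ) : Prop where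
  load_measurable : ∀ n, Measurable (L n)
  load_mem : ∀ n, ∀ᵐ ω ∂P, L n ω = ε₀ ∨ L n ω = 1 - ε₁
  load_prob : ∀ n, P.real {ω | L n ω = ε₀} = ρ
  load_indep : iIndepFun L P
  reward_measurable : ∀ k n, Measurable (X k n)
  reward_mem : ∀ k n, ∀ᵐ ω ∂P, X k n ω ∈ Set.Icc (0 : ℝ) 1
  reward_identDistrib : ∀ k n, IdentDistrib (X k n) (X k 0) P P
  reward_mean : ∀ k n, ∫ ω, X k n ω ∂P = u k
  reward_indep : iIndepFun (fun p : Fin K × ℕ => X p.1 p.2) P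
  load_reward_indep :
    IndepFun (fun ω (n : ℕ) => L n ω) (fun ω (p : Fin K × ℕ) => X p.1 p.2 ω) P

/-- Expected regret of the policy `Γ` over the first `T` slots: the oracle's expected total reward
(it always pulls an arm of the largest mean) minus the expected total actual reward of `Γ`. -/
def regret {K : ℕ} {Ω : Type*} [MeasurableSpace Ω] (P : Measure Ω) (u : Fin K → ℝ)
    (L : ℕ → Ω → ℝ) (X : Fin K → ℕ → Ω → ℝ) (Γ : Policy K) (T : ℕ) : ℝ :=
  (⨆ k, u k) * ∫ ω, ∑ n ∈ Finset.range T, L n ω ∂P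
    - ∑ n ∈ Finset.range T,
        ∫ ω, L n ω * X (action Γ (fun m => L m ω) (fun k m => X k m ω) n) n ω ∂P

end OppBandit

end

namespace OppBandit

/-! Slots of load zero cost nothing, yet AdaUCB uses the full UCB bonus there; at high load the
bonus is multiplied by `√ε₁`. Exploration is thus done for free, and the total cost is finite once
the probability of a wrong pull at high load in slot `n + 1` is summable in `n`.

Write `T = log (n + 1)` and let a bonus mean `√(α T / m)` after `m` pulls. Suppose that up to slot
`n + 1` every empirical mean is within 1/5 of its bonus when `m ≤ M = α T / η ^ 2`, and within `η`
when `m > M`. Suppose also that the second half of the past contains linearly many zero-load slots.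
By pigeonhole, in one of them, `i`, the chosen arm already has more than `M` pulls. Its index
exceeds its mean by at most `2 * η`, so it is the best arm, and every other arm's index is at most
`u kstar + 2 * η`. Hence an arm of gap `Δ` with at most `M` pulls has bonus `B` with `(θ - 1/5) * B
≤ Δ + 2 * η`, where `θ < 1` absorbs the change from `log (i + 1)` to `T`. A pull of that arm at high
load would need `Δ - η ≤ (1/5 + √ε₁) * B`. These conflict for small `η` if `√ε₁ < 3/5`
(`eq_best_of_accurate`).

The accuracy can fail only with probability of order `T * n ^ (-32/25) + n ^ (-2)`
(`measureReal_inaccurate_le`): the union is over pull counts, not over times, and only `O(T)` counts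
are at most `M`. Too few zero loads is exponentially unlikely (`measureReal_card_load_le`). -/

/-! ### Deviations of predictably selected rewards -/

/-- The two hypotheses together make the three variables mutually independent, so they may be
regrouped; the check is made on rectangles. -/
theorem indepFun_prodMk_of_indepFun {Ω α β γ : Type*} {mΩ : MeasurableSpace Ω}
    [MeasurableSpace α] [MeasurableSpace β] [MeasurableSpace γ] {P : Measure Ω}
    [IsProbabilityMeasure P] {f : Ω → α} {g : Ω → β} {h : Ω → γ}
    (hf : Measurable f) (hg : Measurable g) (hh : Measurable h) (hfg : IndepFun f g P)
    (hhfg : IndepFun h (fun ω => (f ω, g ω)) P) :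
    IndepFun f (fun ω => (h ω, g ω)) P := by
  have hhg : IndepFun h g P := hhfg.comp measurable_id measurable_snd
  rw [indepFun_iff_map_prod_eq_prod_map_map hf.aemeasurable (hh.prodMk hg).aemeasurable,
    (indepFun_iff_map_prod_eq_prod_map_map hh.aemeasurable hg.aemeasurable).1 hhg]
  have := Measure.isProbabilityMeasure_map (μ := P) hf.aemeasurable
  have := Measure.isProbabilityMeasure_map (μ := P) hg.aemeasurable
  have := Measure.isProbabilityMeasure_map (μ := P) hh.aemeasurable
  refine Measure.ext_prod₃ ?_
  intro s t v hs ht hv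
  rw [Measure.map_apply (hf.prodMk (hh.prodMk hg)) (hs.prod (ht.prod hv)),
    Measure.prod_prod, Measure.prod_prod, Measure.map_apply hf hs, Measure.map_apply hh ht,
    Measure.map_apply hg hv]
  have h1 := hfg.measure_inter_preimage_eq_mul s v hs hv
  have h2 := hhfg.measure_inter_preimage_eq_mul t (s ×ˢ v) ht (hs.prod hv)
  have e1 : (fun ω => (f ω, g ω)) ⁻¹' s ×ˢ v = f ⁻¹' s ∩ g ⁻¹' v := rfl
  have e2 : (fun ω => (f ω, h ω, g ω)) ⁻¹' s ×ˢ t ×ˢ v = h ⁻¹' t ∩ (f ⁻¹' s ∩ g ⁻¹' v) := by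
    ext ω; simp only [Set.mem_preimage, Set.mem_prod, Set.mem_inter_iff]; tauto
  rw [e2, ← e1, h2, e1, h1]
  ring

/-- The exponential of the compensated sum of the selected rewards is a supermartingale. -/
theorem integral_exp_selected_le_one {Ω : Type*} {mΩ : MeasurableSpace Ω} {P : Measure Ω}
    [IsProbabilityMeasure P] {F : ℕ → MeasurableSpace Ω} (hF : Monotone F) (hFle : ∀ n, F n ≤ mΩ)
    {ξ : ℕ → Ω → ℝ} {b : ℕ → Ω → ℝ} {v : ℝ}
    (hξ : ∀ n, Measurable (ξ n)) (hξF : ∀ i n, i < n → Measurable[F n] (ξ i))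
    (hξI : ∀ n, ∀ᵐ ω ∂P, ξ n ω ∈ Set.Icc (0 : ℝ) 1) (hξv : ∀ n, ∫ ω, ξ n ω ∂P = v)
    (hb : ∀ n, Measurable[F n] (b n)) (hb01 : ∀ n ω, b n ω = 0 ∨ b n ω = 1)
    (hind : ∀ n, Indep (MeasurableSpace.comap (ξ n) inferInstance) (F n) P) (lam : ℝ) (n : ℕ) :
    Integrable (fun ω => Real.exp
      (∑ i ∈ Finset.range n, b i ω * (lam * (ξ i ω - v) - lam ^ 2 / 8))) P ∧
    ∫ ω, Real.exp
      (∑ i ∈ Finset.range n, b i ω * (lam * (ξ i ω - v) - lam ^ 2 / 8)) ∂P ≤ 1 := by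
  induction n with
  | zero => simp
  | succ n ih =>
    obtain ⟨ihi, ihle⟩ := ih
    set W : Ω → ℝ := fun ω =>
      ∑ i ∈ Finset.range n, b i ω * (lam * (ξ i ω - v) - lam ^ 2 / 8) with hW
    have hWm : Measurable[F n] W := by
      refine Finset.measurable_fun_sum _ fun i hi => ?_
      have hi' := Finset.mem_range.1 hi
      have h1 : Measurable[F n] (b i) := (hb i).mono (hF hi'.le) le_rfl
      have h2 := hξF i n hi'
      exact h1.mul (((h2.sub_const v).const_mul lam).sub_const _)
    set A : Ω → ℝ := fun ω => Real.exp (W ω) * b n ω * Real.exp (-lam ^ 2 / 8) with hA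
    have hAm : Measurable[F n] A :=
      ((Real.measurable_exp.comp hWm).mul (hb n)).mul_const _
    set B : Ω → ℝ := fun ω => Real.exp (lam * (ξ n ω - v)) with hB
    have hsub := hasSubgaussianMGF_of_mem_Icc (hξ n).aemeasurable (hξI n)
    rw [hξv n] at hsub
    have hBi : Integrable B P := hsub.integrable_exp_mul lam
    have hBle : ∫ ω, B ω ∂P ≤ Real.exp (lam ^ 2 / 8) := by
      refine (hsub.mgf_le lam).trans (Real.exp_le_exp.2 (le_of_eq ?_))
      simp
      ring
    have hE : Integrable (fun ω => Real.exp (W ω) * b n ω) P := by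
      refine ihi.mono' (((Real.measurable_exp.comp hWm).mul (hb n)).mono
        (hFle n) le_rfl).aestronglyMeasurable (Filter.Eventually.of_forall fun ω => ?_)
      change ‖Real.exp (W ω) * b n ω‖ ≤ Real.exp (W ω)
      rcases hb01 n ω with h | h <;> simp [h, Real.exp_nonneg]
    have hAi : Integrable A P := hE.mul_const _
    have hAB : IndepFun A B P := by
      have : IndepFun (ξ n) A P := by
        rw [IndepFun_iff_Indep]
        exact indep_of_indep_of_le_right (hind n) hAm.comap_le
      exact (this.comp (φ := fun x => Real.exp (lam * (x - v))) (by fun_prop) measurable_id).symm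
    have hABi : Integrable (fun ω => A ω * B ω) P := hAB.integrable_mul hAi hBi
    have hABe := hAB.integral_fun_mul_eq_mul_integral hAi.1 hBi.1
    -- If slot `n` is not selected the exponential is unchanged; if it is, it gains a factor whose
    -- mean is at most 1 by Hoeffding's lemma and which is independent of the past.
    have hsplit : ∀ ω, Real.exp (∑ i ∈ Finset.range (n + 1),
        b i ω * (lam * (ξ i ω - v) - lam ^ 2 / 8)) =
        (Real.exp (W ω) - Real.exp (W ω) * b n ω) + A ω * B ω := by
      intro ω
      have e : ∑ i ∈ Finset.range n, b i ω * (lam * (ξ i ω - v) - lam ^ 2 / 8) = W ω := rfl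
      rw [Finset.sum_range_succ, Real.exp_add, e]
      rcases hb01 n ω with h | h
      · simp [hA, h]
      · simp only [hA, hB, h]
        rw [sub_eq_add_neg, one_mul, Real.exp_add, neg_div]
        ring
    simp_rw [hsplit]
    have hWE : Integrable (fun ω => Real.exp (W ω) - Real.exp (W ω) * b n ω) P := ihi.sub hE
    refine ⟨hWE.add hABi, ?_⟩
    rw [integral_add hWE hABi, integral_sub ihi hE, hABe]
    have hA0 : 0 ≤ ∫ ω, A ω ∂P := integral_nonneg fun ω => by
      rcases hb01 n ω with h | h <;> simp only [hA, h] <;> positivity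
    have hAe : (∫ ω, A ω ∂P) * Real.exp (lam ^ 2 / 8) = ∫ ω, Real.exp (W ω) * b n ω ∂P := by
      rw [hA, integral_mul_const, mul_assoc, ← Real.exp_add]
      simp [neg_div]
    nlinarith [mul_le_mul_of_nonneg_left hBle hA0]

/-- Chernoff's method applied to the supermartingale. Fixing the number of selected terms at `m`
makes the compensator deterministic, so the bound is the one for `m` i.i.d. rewards. -/
theorem measureReal_selected_deviation_le {Ω : Type*} {mΩ : MeasurableSpace Ω} {P : Measure Ω}
    [IsProbabilityMeasure P] {F : ℕ → MeasurableSpace Ω} (hF : Monotone F) (hFle : ∀ n, F n ≤ mΩ)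
    {ξ : ℕ → Ω → ℝ} {b : ℕ → Ω → ℝ} {v : ℝ}
    (hξ : ∀ n, Measurable (ξ n)) (hξF : ∀ i n, i < n → Measurable[F n] (ξ i))
    (hξI : ∀ n, ∀ᵐ ω ∂P, ξ n ω ∈ Set.Icc (0 : ℝ) 1) (hξv : ∀ n, ∫ ω, ξ n ω ∂P = v)
    (hb : ∀ n, Measurable[F n] (b n)) (hb01 : ∀ n ω, b n ω = 0 ∨ b n ω = 1)
    (hind : ∀ n, Indep (MeasurableSpace.comap (ξ n) inferInstance) (F n) P) (n : ℕ) (m δ : ℝ)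
    (hδ : 0 ≤ δ) :
    P.real {ω | ∑ i ∈ Finset.range n, b i ω = m ∧
      m * δ ≤ |∑ i ∈ Finset.range n, b i ω * ξ i ω - m * v|} ≤ 2 * Real.exp (-2 * m * δ ^ 2) := by
  have key : ∀ lam : ℝ, P.real {ω | Real.exp (lam ^ 2 / 8 * m) ≤ Real.exp
      (∑ i ∈ Finset.range n, b i ω * (lam * (ξ i ω - v) - lam ^ 2 / 8))} ≤
      Real.exp (-(lam ^ 2 / 8 * m)) := by
    intro lam
    obtain ⟨hi, hle⟩ := integral_exp_selected_le_one hF hFle hξ hξF hξI hξv hb hb01 hind lam n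
    have := (mul_meas_ge_le_integral_of_nonneg
      (Filter.Eventually.of_forall fun ω => (Real.exp_nonneg _)) hi
      (Real.exp (lam ^ 2 / 8 * m))).trans hle
    rw [Real.exp_neg, ← one_div, le_div_iff₀ (Real.exp_pos _), mul_comm]
    exact this
  -- The exponent `lam * δ - lam ^ 2 / 8` is largest at `lam = 4 * δ`, where it equals `2 * δ ^ 2`;
  -- the opposite sign handles the lower tail.
  have hsub : {ω | ∑ i ∈ Finset.range n, b i ω = m ∧
      m * δ ≤ |∑ i ∈ Finset.range n, b i ω * ξ i ω - m * v|} ⊆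
      {ω | Real.exp ((4 * δ) ^ 2 / 8 * m) ≤ Real.exp
        (∑ i ∈ Finset.range n, b i ω * ((4 * δ) * (ξ i ω - v) - (4 * δ) ^ 2 / 8))} ∪
      {ω | Real.exp ((-(4 * δ)) ^ 2 / 8 * m) ≤ Real.exp
        (∑ i ∈ Finset.range n, b i ω * (-(4 * δ) * (ξ i ω - v) - (-(4 * δ)) ^ 2 / 8))} := by
    rintro ω ⟨hN, hS⟩
    have e : ∀ lam : ℝ, ∑ i ∈ Finset.range n, b i ω * (lam * (ξ i ω - v) - lam ^ 2 / 8) =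
        lam * (∑ i ∈ Finset.range n, b i ω * ξ i ω - m * v) - lam ^ 2 / 8 * m := by
      intro lam
      rw [← hN, Finset.sum_mul, ← Finset.sum_sub_distrib, Finset.mul_sum, Finset.mul_sum,
        ← Finset.sum_sub_distrib]
      exact Finset.sum_congr rfl fun i _ => by ring
    simp only [Set.mem_union, Set.mem_ofPred_eq, Real.exp_le_exp, e]
    rcases le_abs.1 hS with h | h
    · left; nlinarith [mul_le_mul_of_nonneg_left h hδ]
    · right; nlinarith [mul_le_mul_of_nonneg_left h hδ]
  refine (measureReal_mono hsub).trans ((measureReal_union_le _ _).trans ?_)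
  refine (add_le_add (key _) (key _)).trans (le_of_eq ?_)
  have e1 : -((4 * δ) ^ 2 / 8 * m) = -2 * m * δ ^ 2 := by ring
  have e2 : -((-(4 * δ)) ^ 2 / 8 * m) = -2 * m * δ ^ 2 := by ring
  rw [e1, e2]; ring

/-! ### Measurability of the history and the filtration -/

theorem history_apply {K : ℕ} (Γ : Policy K) (l : ℕ → ℝ) (x : Fin K → ℕ → ℝ) (n : ℕ) (i : Fin n) :
    history Γ l x n i = (l i, action Γ l x i, x (action Γ l x i) i) := by
  induction n with
  | zero => exact i.elim0
  | succ n ih =>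
    refine Fin.lastCases ?_ (fun j => ?_) i
    · simp [history, action]
    · simp [history, ih]

theorem measurable_history {K : ℕ} {Ω : Type*} {m : MeasurableSpace Ω} {Γ : Policy K}
    (hΓ : ∀ n : ℕ, Measurable fun p : ℝ × History K n => Γ n p.1 p.2)
    {L : ℕ → Ω → ℝ} {X : Fin K → ℕ → Ω → ℝ} (n : ℕ)
    (hL : ∀ i, Measurable (L i)) (hX : ∀ k i, i < n → Measurable (X k i)) :
    Measurable fun ω => history Γ (fun i => L i ω) (fun k i => X k i ω) n := by
  induction n with
  | zero => exact measurable_pi_lambda _ fun i => i.elim0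
  | succ n ih =>
    have ih' := ih fun k i hi => hX k i (hi.trans n.lt_succ_self)
    have ha : Measurable fun ω =>
        Γ n (L n ω) (history Γ (fun i => L i ω) (fun k i => X k i ω) n) :=
      (hΓ n).comp ((hL n).prodMk ih')
    refine measurable_pi_lambda _ fun i => ?_
    refine Fin.lastCases ?_ (fun j => ?_) i
    · simp only [history, Fin.snoc_last]
      refine (hL n).prodMk (ha.prodMk ?_)
      have : Measurable fun p : Fin K × Ω => X p.1 n p.2 :=
        measurable_from_prod_countable_right fun k => hX k n n.lt_succ_self
      exact this.comp (ha.prodMk measurable_id)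
    · simp only [history, Fin.snoc_castSucc]
      exact (measurable_pi_apply j).comp ih'

theorem measurable_action {K : ℕ} {Ω : Type*} {m : MeasurableSpace Ω} {Γ : Policy K}
    (hΓ : ∀ n : ℕ, Measurable fun p : ℝ × History K n => Γ n p.1 p.2)
    {L : ℕ → Ω → ℝ} {X : Fin K → ℕ → Ω → ℝ} (n : ℕ)
    (hL : ∀ i, Measurable (L i)) (hX : ∀ k i, i < n → Measurable (X k i)) :
    Measurable fun ω => action Γ (fun i => L i ω) (fun k i => X k i ω) n :=
  (hΓ n).comp ((hL n).prodMk (measurable_history hΓ n hL hX))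

/-- All loads together with the rewards of the first `n` slots. -/
abbrev pastData {K : ℕ} {Ω : Type*} (L : ℕ → Ω → ℝ) (X : Fin K → ℕ → Ω → ℝ) (n : ℕ) (ω : Ω) :
    (ℕ → ℝ) × ((Finset.univ ×ˢ Finset.range n : Finset (Fin K × ℕ)) → ℝ) :=
  (fun i => L i ω, fun p => X p.1.1 p.1.2 ω)

/-- The information available in slot `n + 1` before the reward, together with all loads. -/
abbrev pastSigma {K : ℕ} {Ω : Type*} (L : ℕ → Ω → ℝ) (X : Fin K → ℕ → Ω → ℝ) (n : ℕ) :
    MeasurableSpace Ω :=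
  MeasurableSpace.comap (pastData L X n) inferInstance

theorem measurable_load_pastSigma {K : ℕ} {Ω : Type*} (L : ℕ → Ω → ℝ) (X : Fin K → ℕ → Ω → ℝ)
    (n i : ℕ) : Measurable[pastSigma L X n] (L i) :=
  ((measurable_pi_apply i).comp measurable_fst).comp (comap_measurable (pastData L X n))

theorem measurable_reward_pastSigma {K : ℕ} {Ω : Type*} (L : ℕ → Ω → ℝ) (X : Fin K → ℕ → Ω → ℝ)
    {n i : ℕ} (hi : i < n) (k : Fin K) : Measurable[pastSigma L X n] (X k i) :=
  ((measurable_pi_apply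
    (⟨(k, i), by simp [hi]⟩ : (Finset.univ ×ˢ Finset.range n : Finset (Fin K × ℕ)))).comp
      measurable_snd).comp (comap_measurable (pastData L X n))

theorem pastSigma_le {K : ℕ} {Ω : Type*} {m : MeasurableSpace Ω} {L : ℕ → Ω → ℝ}
    {X : Fin K → ℕ → Ω → ℝ} (n : ℕ) (hL : ∀ i, Measurable (L i))
    (hX : ∀ k i, i < n → Measurable (X k i)) : pastSigma L X n ≤ m := by
  refine Measurable.comap_le (Measurable.prodMk (measurable_pi_lambda _ hL)
    (measurable_pi_lambda _ fun p => hX _ _ ?_))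
  have := p.2
  simp only [Finset.mem_product, Finset.mem_range] at this
  exact this.2

theorem pastSigma_mono {K : ℕ} {Ω : Type*} (L : ℕ → Ω → ℝ) (X : Fin K → ℕ → Ω → ℝ) :
    Monotone (pastSigma L X) := fun _ n hmn =>
  pastSigma_le _ (measurable_load_pastSigma L X n)
    fun k _ hi => measurable_reward_pastSigma L X (hi.trans_le hmn) k

/-- The current reward is independent of earlier rewards, and the whole load sequence is independent
of all rewards. Including future loads in the past therefore does no harm. -/
theorem IsRandomBinaryBandit.indep_pastSigma {K : ℕ} {Ω : Type*} [MeasurableSpace Ω]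
    {P : Measure Ω} [IsProbabilityMeasure P] {ε₀ ε₁ ρ : ℝ} {u : Fin K → ℝ} {L : ℕ → Ω → ℝ}
    {X : Fin K → ℕ → Ω → ℝ} (h : IsRandomBinaryBandit P ε₀ ε₁ ρ u L X) (k : Fin K) (n : ℕ) :
    Indep (MeasurableSpace.comap (X k n) inferInstance) (pastSigma L X n) P := by
  have hX : ∀ p : Fin K × ℕ, Measurable (X p.1 p.2) := fun p => h.reward_measurable p.1 p.2
  have h1 : IndepFun (X k n) (fun ω
      (p : (Finset.univ ×ˢ Finset.range n : Finset (Fin K × ℕ))) => X p.1.1 p.1.2 ω) P := by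
    have := h.reward_indep.indepFun_finset {(k, n)} (Finset.univ ×ˢ Finset.range n)
      (by simp) hX
    exact this.comp (measurable_pi_apply
      (⟨(k, n), by simp⟩ : ({(k, n)} : Finset (Fin K × ℕ)))) measurable_id
  have h2 : IndepFun (fun ω i => L i ω) (fun ω => (X k n ω, fun
      (p : (Finset.univ ×ˢ Finset.range n : Finset (Fin K × ℕ))) => X p.1.1 p.1.2 ω)) P :=
    h.load_reward_indep.comp
      (ψ := fun x : Fin K × ℕ → ℝ => (x (k, n), fun
        (p : (Finset.univ ×ˢ Finset.range n : Finset (Fin K × ℕ))) => x p.1)) measurable_id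
      (by fun_prop)
  exact (IndepFun_iff_Indep _ _ _).1 (indepFun_prodMk_of_indepFun (h.reward_measurable k n)
    (measurable_pi_lambda _ fun p => hX p.1) (measurable_pi_lambda _ h.load_measurable) h1 h2)

/-! ### Pull counts and concentration at a given count -/

/-- Number of `i < n` with `a i = j`. -/
def armCount {K : ℕ} (a : ℕ → Fin K) (j : Fin K) (n : ℕ) : ℕ :=
  ((Finset.range n).filter fun i => a i = j).card

/-- Sum of the rewards of arm `j` collected in the first `n` slots. -/
noncomputable def armSum {K : ℕ} (a : ℕ → Fin K) (x : Fin K → ℕ → ℝ) (j : Fin K) (n : ℕ) : ℝ :=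
  ∑ i ∈ (Finset.range n).filter (fun i => a i = j), x j i

theorem pulls_history {K : ℕ} (Γ : Policy K) (l : ℕ → ℝ) (x : Fin K → ℕ → ℝ) (n : ℕ)
    (j : Fin K) : pulls (history Γ l x n) j = armCount (action Γ l x) j n := by
  simp only [pulls, armCount, history_apply, Finset.card_filter]
  exact Fin.sum_univ_eq_sum_range (fun i => if action Γ l x i = j then 1 else 0) n

theorem empMean_history {K : ℕ} (Γ : Policy K) (l : ℕ → ℝ) (x : Fin K → ℕ → ℝ) (n : ℕ)
    (j : Fin K) : empMean (history Γ l x n) j =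
      armSum (action Γ l x) x j n / armCount (action Γ l x) j n := by
  simp only [empMean, pulls_history, history_apply]
  congr 1
  simp only [armSum, Finset.sum_filter]
  rw [← Fin.sum_univ_eq_sum_range (fun i => if action Γ l x i = j then x j i else 0) n]
  refine Finset.sum_congr rfl fun i _ => ?_
  split_ifs with hi
  · rw [hi]
  · rfl

theorem armCount_mono {K : ℕ} (a : ℕ → Fin K) (j : Fin K) : Monotone (armCount a j) :=
  fun _ _ h => Finset.card_le_card
    (Finset.filter_subset_filter _ (Finset.range_subset_range.2 h))

theorem armCount_lt {K : ℕ} {a : ℕ → Fin K} {j : Fin K} {r i : ℕ} (hri : r < i) (hr : a r = j) :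
    armCount a j r < armCount a j i := by
  refine lt_of_lt_of_le ?_ (armCount_mono a j (Nat.succ_le_of_lt hri))
  simp [armCount, Finset.range_add_one, Finset.filter_insert, hr]

theorem filter_range_armCount_lt {K : ℕ} (a : ℕ → Fin K) (j : Fin K) {i n : ℕ} (hin : i ≤ n) :
    (Finset.range n).filter (fun r => a r = j ∧ armCount a j r < armCount a j i) =
      (Finset.range i).filter (fun r => a r = j) := by
  ext r
  simp only [Finset.mem_filter, Finset.mem_range]
  constructor
  · rintro ⟨_, h1, h2⟩
    refine ⟨?_, h1⟩
    by_contra h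
    exact absurd (armCount_mono a j (not_lt.1 h)) (not_le.2 h2)
  · rintro ⟨h1, h2⟩
    exact ⟨h1.trans_le hin, h2, armCount_lt h1 h2⟩

/-- All times `i` at which the count equals `m` share the same first `m` pulls, hence the same sum
of rewards. The quantifier over `i` therefore costs no union bound. -/
theorem IsRandomBinaryBandit.measureReal_armSum_deviation_le {K : ℕ} {Ω : Type*}
    [MeasurableSpace Ω] {P : Measure Ω} [IsProbabilityMeasure P] {ε₀ ε₁ ρ : ℝ} {u : Fin K → ℝ}
    {L : ℕ → Ω → ℝ} {X : Fin K → ℕ → Ω → ℝ} (h : IsRandomBinaryBandit P ε₀ ε₁ ρ u L X)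
    {Γ : Policy K} (hΓ : ∀ n : ℕ, Measurable fun p : ℝ × History K n => Γ n p.1 p.2)
    (j : Fin K) (n m : ℕ) {δ : ℝ} (hδ : 0 ≤ δ) :
    P.real {ω | ∃ i ≤ n,
      armCount (action Γ (fun i => L i ω) (fun k i => X k i ω)) j i = m ∧
      m * δ ≤ |armSum (action Γ (fun i => L i ω) (fun k i => X k i ω)) (fun k i => X k i ω) j i
        - m * u j|} ≤ 2 * Real.exp (-2 * m * δ ^ 2) := by
  classical
  set a : Ω → ℕ → Fin K := fun ω => action Γ (fun i => L i ω) (fun k i => X k i ω) with ha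
  have ham : ∀ n r, r ≤ n → Measurable[pastSigma L X n] fun ω => a ω r := fun n r hr =>
    measurable_action hΓ r (measurable_load_pastSigma L X n)
      fun k i hi => measurable_reward_pastSigma L X (hi.trans_le hr) k
  have hNm : ∀ n, Measurable[pastSigma L X n] fun ω => armCount (a ω) j n := by
    intro n
    simp only [armCount, Finset.card_filter]
    refine Finset.measurable_fun_sum _ fun i hi => ?_
    refine Measurable.ite ?_ measurable_const measurable_const
    exact ham n i (Finset.mem_range.1 hi).le (measurableSet_singleton j)
  -- Selects the first `m` pulls of arm `j`; predictable, since the count is taken before slot `r`.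
  set b : ℕ → Ω → ℝ := fun r ω => if a ω r = j ∧ armCount (a ω) j r < m then 1 else 0 with hb
  have hbm : ∀ n, Measurable[pastSigma L X n] (b n) := by
    intro n
    refine Measurable.ite ?_ measurable_const measurable_const
    exact MeasurableSet.inter (ham n n le_rfl (measurableSet_singleton j))
      (hNm n (measurableSet_Iio (a := m)))
  have main := measureReal_selected_deviation_le (P := P) (F := pastSigma L X) (ξ := X j) (b := b)
    (v := u j) (pastSigma_mono L X)
    (fun n => pastSigma_le n h.load_measurable fun k i _ => h.reward_measurable k i)
    (h.reward_measurable j) (fun i n hi => measurable_reward_pastSigma L X hi j)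
    (h.reward_mem j) (h.reward_mean j) hbm
    (fun n ω => by simp only [hb]; split_ifs <;> simp) (h.indep_pastSigma j) n m δ hδ
  refine (measureReal_mono ?_).trans main
  rintro ω ⟨i, hin, hm, hdev⟩
  have hf := filter_range_armCount_lt (a ω) j hin
  rw [hm] at hf
  have e1 : ∑ r ∈ Finset.range n, b r ω = m := by
    simp only [hb, ← Finset.sum_filter]
    rw [hf, ← hm, Finset.sum_const, nsmul_eq_mul, mul_one]
    rfl
  have e2 : ∑ r ∈ Finset.range n, b r ω * X j r ω = armSum (a ω) (fun k i => X k i ω) j i := by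
    simp only [hb, ite_mul, one_mul, zero_mul, ← Finset.sum_filter, hf, armSum]
  refine ⟨e1, ?_⟩
  rw [e2]
  exact hdev

/-! ### The deterministic argument on the good event -/

/-- The count of an arm is distinct at each of its pulls, so an arm can be pulled at most `⌊M⌋₊ + 1`
times while its count is at most `M`. -/
theorem exists_armCount_gt {K : ℕ} (a : ℕ → Fin K) (s : Finset ℕ) {M : ℝ} (hM : 0 ≤ M)
    (hs : K * (M + 1) < s.card) : ∃ i ∈ s, M < armCount a (a i) i := by
  by_contra! hcon
  have h1 : s.card ≤ K * (⌊M⌋₊ + 1) := by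
    rw [Finset.card_eq_sum_card_fiberwise (f := a) (t := Finset.univ) (fun _ _ => by simp)]
    refine (Finset.sum_le_card_nsmul _ _ (⌊M⌋₊ + 1) fun j _ => ?_).trans (by simp)
    rw [← Finset.card_range (⌊M⌋₊ + 1)]
    refine Finset.card_le_card_of_injOn (fun i => armCount a j i) (fun i hi => ?_) ?_
    · obtain ⟨hi1, hi2⟩ := Finset.mem_filter.1 hi
      have := hcon i hi1
      rw [hi2] at this
      simpa [Nat.lt_succ_iff] using Nat.le_floor this
    · intro i hi i' hi' heq
      have hi2 := (Finset.mem_filter.1 hi).2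
      have hi2' := (Finset.mem_filter.1 hi').2
      rcases lt_trichotomy i i' with h | h | h
      · exact absurd heq (armCount_lt h hi2).ne
      · exact h
      · exact absurd heq (armCount_lt h hi2').ne'
  have h2 : (s.card : ℝ) ≤ K * (⌊M⌋₊ + 1) := by exact_mod_cast h1
  have h3 := Nat.floor_le hM
  have h4 : (0 : ℝ) ≤ K := Nat.cast_nonneg K
  nlinarith

/-- On the event where all empirical means are accurate and there were enough slots of zero load,
a slot of high load is spent on the best arm. -/
theorem eq_best_of_accurate {K n : ℕ} {a : ℕ → Fin K} {l : ℕ → ℝ} {x : Fin K → ℕ → ℝ}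
    {u : Fin K → ℝ} {kstar : Fin K} {α ε₁ η θ gap : ℝ} (hα : 0 < α) (hε0 : 0 ≤ ε₁) (hε1 : ε₁ ≤ 1)
    (hη : 0 < η) (hθ : θ ≤ 1) (hgap : ∀ k, k ≠ kstar → gap ≤ u kstar - u k)
    (hθε : 1 / 5 + √ε₁ < θ - 1 / 5) (hηg : 3 * η < (θ - 1 / 5 - (1 / 5 + √ε₁)) * gap)
    (hpos : ∀ i, K ≤ i → ∀ j, 0 < armCount a j i)
    (hlow : ∀ i, K ≤ i → i < n → l i = 0 → ∀ j,
      armSum a x j i / armCount a j i + √(α * Real.log (i + 1) / armCount a j i) ≤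
      armSum a x (a i) i / armCount a (a i) i + √(α * Real.log (i + 1) / armCount a (a i) i))
    (hhigh : ∀ j,
      armSum a x j n / armCount a j n + √(α * ε₁ * Real.log (n + 1) / armCount a j n) ≤
      armSum a x (a n) n / armCount a (a n) n +
        √(α * ε₁ * Real.log (n + 1) / armCount a (a n) n))
    (hconc : ∀ i ≤ n, ∀ j, 0 < armCount a j i →
      |armSum a x j i / armCount a j i - u j| ≤
        if (armCount a j i : ℝ) ≤ α / η ^ 2 * Real.log (n + 1) then
          1 / 5 * √(α * Real.log (n + 1) / armCount a j i) else η)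
    (hcount : K * (α / η ^ 2 * Real.log (n + 1) + 1) <
      ((Finset.Ico ((n + 1) / 2) n).filter fun i => l i = 0).card)
    (hK : K ≤ (n + 1) / 2)
    (hlog : ∀ i, (n + 1) / 2 ≤ i → θ ^ 2 * Real.log (n + 1) ≤ Real.log (i + 1)) :
    a n = kstar := by
  set T : ℝ := Real.log (n + 1) with hT
  have hT0 : 0 ≤ T := Real.log_nonneg (by linarith [(Nat.cast_nonneg n : (0 : ℝ) ≤ n)])
  set M : ℝ := α / η ^ 2 * T with hM
  have hM0 : 0 ≤ M := by positivity
  have hsε : 0 ≤ √ε₁ := Real.sqrt_nonneg _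
  have hsε1 : √ε₁ ≤ 1 := Real.sqrt_le_one.2 hε1
  by_contra hne
  have hgap' := hgap _ hne
  have hgap0 : 0 < gap := by
    by_contra h
    nlinarith [mul_nonneg (sub_nonneg.2 hθε.le) (neg_nonneg.2 (not_lt.1 h))]
  have hη3 : 3 * η < gap := by nlinarith
  obtain ⟨i, hi, hMi⟩ := exists_armCount_gt a _ hM0 hcount
  simp only [Finset.mem_filter, Finset.mem_Ico] at hi
  obtain ⟨⟨hi1, hi2⟩, hli⟩ := hi
  have hKi : K ≤ i := hK.trans hi1
  have hlogi : Real.log (i + 1) ≤ T :=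
    Real.log_le_log (by positivity) (by exact_mod_cast Nat.succ_le_succ hi2.le)
  have hlogi' := hlog i hi1
  have hbonus : ∀ {m s : ℝ}, M < m → s ≤ T → √(α * s / m) ≤ η := by
    intro m s hm hs
    rw [Real.sqrt_le_left hη.le, div_le_iff₀ (hM0.trans_lt hm)]
    have : α * T = η ^ 2 * M := by rw [hM]; field_simp
    nlinarith [sq_nonneg η, pow_pos hη 2]
  have hacc : ∀ i' ≤ n, ∀ j, M < armCount a j i' →
      |armSum a x j i' / armCount a j i' - u j| ≤ η := by
    intro i' hi' j hj
    have h := hconc i' hi' j (by exact_mod_cast hM0.trans_lt hj)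
    rwa [if_neg (not_le.2 hj)] at h
  have hlowb : ∀ j, θ * √(α * T / armCount a j i) ≤ √(α * Real.log (i + 1) / armCount a j i) := by
    intro j
    have hθ0 : 0 ≤ θ := by linarith
    rw [← Real.sqrt_sq hθ0, ← Real.sqrt_mul (sq_nonneg θ)]
    refine Real.sqrt_le_sqrt ?_
    rw [← mul_div_assoc]
    gcongr ?_ / _
    nlinarith
  -- Optimism at zero load: below `M` pulls, the bonus is at least `θ ≥ 1/5` times the reference
  -- bonus and covers the error; above `M`, the error is at most `η`.
  have hlower : u kstar - η ≤ armSum a x kstar i / armCount a kstar i +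
      √(α * Real.log (i + 1) / armCount a kstar i) := by
    have h := hconc i hi2.le kstar (hpos i hKi kstar)
    have h0 := Real.sqrt_nonneg (α * T / armCount a kstar i)
    have h1 := hlowb kstar
    split_ifs at h with hc
    · have := (abs_le.1 h).1
      nlinarith
    · have := (abs_le.1 h).1
      linarith [Real.sqrt_nonneg (α * Real.log (i + 1) / armCount a kstar i)]
  have hai : a i = kstar := by
    by_contra hne'
    have h1 := hlow i hKi hi2 hli kstar
    have h2 := (abs_le.1 (hacc i hi2.le _ hMi)).2
    have h3 := hbonus hMi hlogi
    linarith [hgap _ hne']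
  rw [hai] at hMi
  have hMn : M < armCount a kstar n := hMi.trans_le (by exact_mod_cast armCount_mono a kstar hi2.le)
  have hstar_n := (abs_le.1 (hacc n le_rfl kstar hMn)).1
  have hhigh' := hhigh kstar
  have hbn := Real.sqrt_nonneg (α * ε₁ * T / armCount a kstar n)
  have hεb : √(α * ε₁ * T / armCount a (a n) n) = √ε₁ * √(α * T / armCount a (a n) n) := by
    rw [← Real.sqrt_mul hε0]; congr 1; ring
  rw [hεb] at hhigh'
  by_cases hc : (armCount a (a n) n : ℝ) ≤ M
  · have hkpos := hpos i hKi (a n)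
    have hkle : armCount a (a n) i ≤ armCount a (a n) n := armCount_mono a (a n) hi2.le
    have hcle : (armCount a (a n) i : ℝ) ≤ armCount a (a n) n := by exact_mod_cast hkle
    have hkn := hconc n le_rfl (a n) (hkpos.trans_le hkle)
    rw [if_pos hc] at hkn
    have hki := hconc i hi2.le (a n) hkpos
    rw [if_pos (hcle.trans hc)] at hki
    have h1 := hlow i hKi hi2 hli (a n)
    rw [hai] at h1
    have h2 := (abs_le.1 (hacc i hi2.le _ hMi)).2
    have h3 := hbonus hMi hlogi
    have h4 := hlowb (a n)
    have h5 := (abs_le.1 hki).1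
    have h6 := (abs_le.1 hkn).2
    have hBle : √(α * T / armCount a (a n) n) ≤ √(α * T / armCount a (a n) i) := by
      refine Real.sqrt_le_sqrt ?_
      have : (0 : ℝ) < armCount a (a n) i := by exact_mod_cast hkpos
      gcongr
    set B := √(α * T / armCount a (a n) n)
    set B' := √(α * T / armCount a (a n) i)
    set Δ := u kstar - u (a n) with hΔ
    -- `h7` comes from losing to the best arm in slot `i`, `h8` from beating it in slot `n`. The
    -- count has only grown in between, so `B ≤ B'` and `B` can be eliminated.
    have h7 : (θ - 1 / 5) * B' ≤ Δ + 2 * η := by rw [hΔ]; linarith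
    have h8 : Δ - η ≤ (1 / 5 + √ε₁) * B := by rw [hΔ]; linarith
    have h9 : (θ - 1 / 5) * B ≤ Δ + 2 * η :=
      (mul_le_mul_of_nonneg_left hBle (by linarith)).trans h7
    have h10 : (θ - 1 / 5) * (Δ - η) ≤ (1 / 5 + √ε₁) * (Δ + 2 * η) := by
      calc (θ - 1 / 5) * (Δ - η) ≤ (θ - 1 / 5) * ((1 / 5 + √ε₁) * B) :=
            mul_le_mul_of_nonneg_left h8 (by linarith)
        _ = (1 / 5 + √ε₁) * ((θ - 1 / 5) * B) := by ring
        _ ≤ _ := mul_le_mul_of_nonneg_left h9 (by linarith)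
    have h11 : (θ - 1 / 5 - (1 / 5 + √ε₁)) * gap ≤ (θ - 1 / 5 - (1 / 5 + √ε₁)) * Δ :=
      mul_le_mul_of_nonneg_left hgap' (by linarith)
    have h12 : (θ - 1 / 5 + 2 * (1 / 5 + √ε₁)) * η ≤ 3 * η :=
      mul_le_mul_of_nonneg_right (by linarith) hη.le
    linarith
  -- A suboptimal arm with more than `M` pulls has index at most its mean plus `2 * η`, below `u
  -- kstar - η`.
  · have hc' := not_le.1 hc
    have h1 := (abs_le.1 (hacc n le_rfl (a n) hc')).2
    have h2 := hbonus hc' le_rfl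
    have h3 := mul_le_mul_of_nonneg_right hsε1 (Real.sqrt_nonneg (α * T / armCount a (a n) n))
    linarith

theorem armCount_pos_of_init {K : ℕ} {a : ℕ → Fin K}
    (h : ∀ n < K, armCount a (a n) n = 0) {i : ℕ} (hi : K ≤ i) (j : Fin K) :
    0 < armCount a j i := by
  have hinj : Function.Injective fun r : Fin K => a r := by
    intro r r' heq
    simp only at heq
    rcases lt_trichotomy r r' with hr | hr | hr
    · have := armCount_lt (a := a) (j := a r') (r := r) (i := r') hr heq
      rw [h r' r'.2] at this
      omega
    · exact hr
    · have := armCount_lt (a := a) (j := a r) (r := r') (i := r) hr heq.symm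
      rw [h r r.2] at this
      omega
  obtain ⟨r, hr⟩ := (Finite.injective_iff_surjective.1 hinj) j
  exact (Nat.zero_le _).trans_lt (armCount_lt (r.2.trans_le hi) hr)

/-! ### Probabilities of the bad events -/

/-- In most blocks of slots, at least half of the expected number of slots have load `ε₀`. -/
theorem IsRandomBinaryBandit.measureReal_card_load_le {K : ℕ} {Ω : Type*}
    [MeasurableSpace Ω] {P : Measure Ω} [IsProbabilityMeasure P] {ε₀ ε₁ ρ : ℝ} {u : Fin K → ℝ}
    {L : ℕ → Ω → ℝ} {X : Fin K → ℕ → Ω → ℝ} (h : IsRandomBinaryBandit P ε₀ ε₁ ρ u L X)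
    (hρ : 0 ≤ ρ) (s : Finset ℕ) :
    P.real {ω | ((s.filter fun i => L i ω = ε₀).card : ℝ) ≤ ρ * s.card / 2} ≤
      Real.exp (-(ρ ^ 2 * s.card / 2)) := by
  classical
  set f : ℝ → ℝ := fun y => if y = ε₀ then 1 else 0 with hf
  have hfm : Measurable f :=
    Measurable.ite (measurableSet_singleton ε₀) measurable_const measurable_const
  have hmean : ∀ i, ∫ ω, f (L i ω) ∂P = ρ := by
    intro i
    rw [← h.load_prob i]
    refine Eq.trans ?_ (integral_indicator_one
      (h.load_measurable i (measurableSet_singleton ε₀)))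
    refine integral_congr_ae (Filter.Eventually.of_forall fun ω => ?_)
    simp [hf, Set.indicator_apply]
  -- The sign is reversed because the event is a lower tail.
  have hind : iIndepFun (fun i ω => -(f (L i ω) - ρ)) P :=
    h.load_indep.comp (fun _ y => -(f y - ρ)) fun _ => (hfm.sub_const ρ).neg
  have hsub : ∀ i ∈ s, HasSubgaussianMGF (fun ω => -(f (L i ω) - ρ)) ((1 / 2) ^ 2) P := by
    intro i _
    have := hasSubgaussianMGF_of_mem_Icc (X := fun ω => f (L i ω)) (μ := P) (a := 0) (b := 1)
      (hfm.comp (h.load_measurable i)).aemeasurable (Filter.Eventually.of_forall fun ω => by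
        simp only [hf]; split_ifs <;> simp)
    rw [hmean i] at this
    have e : (‖(1 : ℝ) - 0‖₊ / 2) ^ 2 = (1 / 2) ^ 2 := by simp
    rw [e] at this
    exact this.neg
  have main := HasSubgaussianMGF.measure_sum_ge_le_of_iIndepFun hind hsub
    (ε := ρ * s.card / 2) (by positivity)
  refine (measureReal_mono ?_).trans (main.trans (Real.exp_le_exp.2 (le_of_eq ?_)))
  · intro ω hω
    simp only [Set.mem_ofPred_eq] at hω ⊢
    have : ((s.filter fun i => L i ω = ε₀).card : ℝ) = ∑ i ∈ s, f (L i ω) := by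
      simp [hf]
    rw [Finset.sum_neg_distrib, Finset.sum_sub_distrib, ← this]
    simp
    linarith
  · rcases eq_or_ne (s.card : ℝ) 0 with h0 | h0
    · simp [h0]
    · simp
      field_simp

/-- The accuracy required of the empirical mean of `m` rewards at time `exp T`. -/
noncomputable def accuracy (α η T : ℝ) (m : ℕ) : ℝ :=
  if (m : ℝ) ≤ α / η ^ 2 * T then 1 / 5 * √(α * T / m) else η

/-- The two accuracy regimes are summed separately: at most `α / η ^ 2 * T` small counts, and at
most `n` large ones with a much smaller probability each. -/
theorem sum_exp_accuracy_le {α η T : ℝ} (hα : 16 ≤ α) (hη : 0 < η) (hT : 0 ≤ T) (n : ℕ) :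
    ∑ m ∈ Finset.Icc 1 n, 2 * Real.exp (-2 * m * accuracy α η T m ^ 2) ≤
      2 * (α / η ^ 2 * T) * Real.exp (-(32 / 25) * T) + 2 * n * Real.exp (-3 * T) := by
  have hM0 : 0 ≤ α / η ^ 2 * T := by positivity
  have hterm : ∀ m ∈ Finset.Icc 1 n, 2 * Real.exp (-2 * m * accuracy α η T m ^ 2) ≤
      (if (m : ℝ) ≤ α / η ^ 2 * T then 2 * Real.exp (-(32 / 25) * T) else 0) +
        2 * Real.exp (-3 * T) := by
    intro m hm
    have hm0 : (0 : ℝ) < m := by exact_mod_cast (Finset.mem_Icc.1 hm).1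
    unfold accuracy
    split_ifs with hc
    -- The exponent is `-(2 / 25) * α * T`. With `α ≥ 16` the rate 32/25 exceeds 1, which
    -- summability over slots requires.
    · have : -2 * (m : ℝ) * (1 / 5 * √(α * T / m)) ^ 2 ≤ -(32 / 25) * T := by
        rw [mul_pow, Real.sq_sqrt (by positivity)]
        have : -2 * (m : ℝ) * ((1 / 5) ^ 2 * (α * T / m)) = -(2 / 25) * (α * T) := by
          field_simp
          ring
        rw [this]
        nlinarith
      have := Real.exp_le_exp.2 this
      linarith [Real.exp_pos (-3 * T)]
    · have : -2 * (m : ℝ) * η ^ 2 ≤ -3 * T := by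
        have h1 := mul_le_mul_of_nonneg_right (not_le.1 hc).le (sq_nonneg η)
        have : α / η ^ 2 * T * η ^ 2 = α * T := by field_simp
        rw [this] at h1
        nlinarith
      have := Real.exp_le_exp.2 this
      linarith
  refine (Finset.sum_le_sum hterm).trans ?_
  rw [Finset.sum_add_distrib, ← Finset.sum_filter, Finset.sum_const, Finset.sum_const]
  simp only [Nat.card_Icc, add_tsub_cancel_right, nsmul_eq_mul]
  have hcard : (((Finset.Icc 1 n).filter fun m : ℕ => (m : ℝ) ≤ α / η ^ 2 * T).card : ℝ) ≤
      α / η ^ 2 * T := by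
    refine le_trans ?_ (Nat.floor_le hM0)
    have : ((Finset.Icc 1 n).filter fun m : ℕ => (m : ℝ) ≤ α / η ^ 2 * T).card ≤
        (Finset.Icc 1 ⌊α / η ^ 2 * T⌋₊).card := by
      refine Finset.card_le_card fun m hm => ?_
      simp only [Finset.mem_filter, Finset.mem_Icc] at hm ⊢
      exact ⟨hm.1.1, Nat.le_floor hm.2⟩
    rw [Nat.card_Icc, add_tsub_cancel_right] at this
    exact_mod_cast this
  have h1 := mul_le_mul_of_nonneg_right hcard (Real.exp_pos (-(32 / 25) * T)).le
  linarith

/-- All empirical means of the first `n` slots are accurate, except on a small event. -/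
theorem IsRandomBinaryBandit.measureReal_inaccurate_le {K : ℕ} {Ω : Type*}
    [MeasurableSpace Ω] {P : Measure Ω} [IsProbabilityMeasure P] {ε₀ ε₁ ρ : ℝ} {u : Fin K → ℝ}
    {L : ℕ → Ω → ℝ} {X : Fin K → ℕ → Ω → ℝ} (h : IsRandomBinaryBandit P ε₀ ε₁ ρ u L X)
    {Γ : Policy K} (hΓ : ∀ n : ℕ, Measurable fun p : ℝ × History K n => Γ n p.1 p.2)
    {α η T : ℝ} (hα : 16 ≤ α) (hη : 0 < η) (hT : 0 ≤ T) (n : ℕ) :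
    P.real {ω | ∃ i ≤ n, ∃ j,
      0 < armCount (action Γ (fun i => L i ω) (fun k i => X k i ω)) j i ∧
      accuracy α η T (armCount (action Γ (fun i => L i ω) (fun k i => X k i ω)) j i) <
        |armSum (action Γ (fun i => L i ω) (fun k i => X k i ω)) (fun k i => X k i ω) j i /
          armCount (action Γ (fun i => L i ω) (fun k i => X k i ω)) j i - u j|} ≤
      K * (2 * (α / η ^ 2 * T) * Real.exp (-(32 / 25) * T) + 2 * n * Real.exp (-3 * T)) := by
  set E : Fin K → ℕ → Set Ω := fun j m => {ω | ∃ i ≤ n,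
      armCount (action Γ (fun i => L i ω) (fun k i => X k i ω)) j i = m ∧
      m * accuracy α η T m ≤ |armSum (action Γ (fun i => L i ω) (fun k i => X k i ω))
        (fun k i => X k i ω) j i - m * u j|} with hE
  have hsub : {ω | ∃ i ≤ n, ∃ j,
      0 < armCount (action Γ (fun i => L i ω) (fun k i => X k i ω)) j i ∧
      accuracy α η T (armCount (action Γ (fun i => L i ω) (fun k i => X k i ω)) j i) <
        |armSum (action Γ (fun i => L i ω) (fun k i => X k i ω)) (fun k i => X k i ω) j i /
          armCount (action Γ (fun i => L i ω) (fun k i => X k i ω)) j i - u j|} ⊆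
      ⋃ j ∈ Finset.univ, ⋃ m ∈ Finset.Icc 1 n, E j m := by
    rintro ω ⟨i, hin, j, hpos, hdev⟩
    have hle : armCount (action Γ (fun i => L i ω) (fun k i => X k i ω)) j i ≤ n :=
      (Finset.card_filter_le _ _).trans (by simpa using hin)
    simp only [Set.mem_iUnion, Finset.mem_univ, Finset.mem_Icc, exists_prop, true_and]
    refine ⟨j, _, ⟨hpos, hle⟩, i, hin, rfl, ?_⟩
    have hp : (0 : ℝ) < armCount (action Γ (fun i => L i ω) (fun k i => X k i ω)) j i := by
      exact_mod_cast hpos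
    refine (mul_le_mul_of_nonneg_left hdev.le hp.le).trans (le_of_eq ?_)
    rw [← abs_of_pos hp, ← abs_mul, abs_of_pos hp, mul_sub, mul_div_cancel₀ _ hp.ne']
  have hacc0 : ∀ m, 0 ≤ accuracy α η T m := by
    intro m; unfold accuracy; split_ifs <;> positivity
  calc _ ≤ P.real (⋃ j ∈ Finset.univ, ⋃ m ∈ Finset.Icc 1 n, E j m) :=
        measureReal_mono hsub (measure_ne_top _ _)
    _ ≤ ∑ j : Fin K, P.real (⋃ m ∈ Finset.Icc 1 n, E j m) := measureReal_biUnion_finset_le _ _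
    _ ≤ ∑ j : Fin K, ∑ m ∈ Finset.Icc 1 n, P.real (E j m) :=
        Finset.sum_le_sum fun j _ => measureReal_biUnion_finset_le _ _
    _ ≤ ∑ j : Fin K, ∑ m ∈ Finset.Icc 1 n, 2 * Real.exp (-2 * m * accuracy α η T m ^ 2) :=
        Finset.sum_le_sum fun j _ => Finset.sum_le_sum fun m _ =>
          h.measureReal_armSum_deviation_le hΓ j n m (hacc0 m)
    _ ≤ ∑ j : Fin K, (2 * (α / η ^ 2 * T) * Real.exp (-(32 / 25) * T) +
          2 * n * Real.exp (-3 * T)) :=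
        Finset.sum_le_sum fun j _ => sum_exp_accuracy_le hα hη hT n
    _ = _ := by rw [Finset.sum_const, Finset.card_univ, Fintype.card_fin, nsmul_eq_mul]

/-! ### Regret decomposition -/

/-- Regret in terms of the load spent on each arm. -/
theorem IsRandomBinaryBandit.regret_eq {K : ℕ} {Ω : Type*}
    [MeasurableSpace Ω] {P : Measure Ω} [IsProbabilityMeasure P] {ε₀ ε₁ ρ : ℝ} {u : Fin K → ℝ}
    {L : ℕ → Ω → ℝ} {X : Fin K → ℕ → Ω → ℝ} (h : IsRandomBinaryBandit P ε₀ ε₁ ρ u L X)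
    {Γ : Policy K} (hΓ : ∀ n : ℕ, Measurable fun p : ℝ × History K n => Γ n p.1 p.2) (T : ℕ) :
    regret P u L X Γ T = ∑ n ∈ Finset.range T, ∑ j, ((⨆ k, u k) - u j) *
      ∫ ω, (if action Γ (fun i => L i ω) (fun k i => X k i ω) n = j then L n ω else 0) ∂P := by
  set a : Ω → ℕ → Fin K := fun ω => action Γ (fun i => L i ω) (fun k i => X k i ω) with ha
  set g : ℕ → Fin K → Ω → ℝ := fun n j ω => if a ω n = j then L n ω else 0 with hg
  have hgm : ∀ n j, Measurable[pastSigma L X n] (g n j) := by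
    intro n j
    refine Measurable.ite ?_ (measurable_load_pastSigma L X n n) measurable_const
    exact measurable_action hΓ n (measurable_load_pastSigma L X n)
      (fun k i hi => measurable_reward_pastSigma L X hi k) (measurableSet_singleton j)
  have hgm' : ∀ n j, Measurable (g n j) := fun n j =>
    (hgm n j).mono (pastSigma_le n h.load_measurable fun k i _ => h.reward_measurable k i) le_rfl
  have hLi : ∀ n, Integrable (L n) P := by
    intro n
    refine Integrable.of_bound (h.load_measurable n).aestronglyMeasurable (|ε₀| + |1 - ε₁|) ?_
    filter_upwards [h.load_mem n] with ω hω
    rw [Real.norm_eq_abs]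
    rcases hω with hω | hω <;> rw [hω] <;> linarith [abs_nonneg ε₀, abs_nonneg (1 - ε₁)]
  have hgi : ∀ n j, Integrable (g n j) P := by
    intro n j
    refine (hLi n).mono (hgm' n j).aestronglyMeasurable (Filter.Eventually.of_forall fun ω => ?_)
    simp only [hg]; split_ifs <;> simp
  have hXi : ∀ k n, Integrable (X k n) P := by
    intro k n
    refine Integrable.of_bound (h.reward_measurable k n).aestronglyMeasurable 1 ?_
    filter_upwards [h.reward_mem k n] with ω hω
    rw [Real.norm_eq_abs, abs_of_nonneg hω.1]
    exact hω.2
  -- The arm of slot `n` is chosen before its reward is seen, so `X j n` can be replaced by its mean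
  -- `u j`.
  have hindep : ∀ n j, IndepFun (g n j) (X j n) P := by
    intro n j
    rw [IndepFun_iff_Indep]
    exact (indep_of_indep_of_le_right (h.indep_pastSigma j n) (hgm n j).comap_le).symm
  have hLg : ∀ n, ∫ ω, L n ω ∂P = ∑ j, ∫ ω, g n j ω ∂P := by
    intro n
    rw [← integral_finsetSum _ fun j _ => hgi n j]
    refine integral_congr_ae (Filter.Eventually.of_forall fun ω => ?_)
    simp [hg]
  have hLX : ∀ n, ∫ ω, L n ω * X (a ω n) n ω ∂P = ∑ j, u j * ∫ ω, g n j ω ∂P := by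
    intro n
    have : ∀ j, u j * ∫ ω, g n j ω ∂P = ∫ ω, g n j ω * X j n ω ∂P := by
      intro j
      rw [(hindep n j).integral_fun_mul_eq_mul_integral (hgi n j).1 (hXi j n).1,
        h.reward_mean, mul_comm]
    simp_rw [this]
    have hgX : ∀ j, Integrable (fun ω => g n j ω * X j n ω) P := fun j =>
      (hindep n j).integrable_mul (hgi n j) (hXi j n)
    rw [← integral_finsetSum _ fun j _ => hgX j]
    refine integral_congr_ae (Filter.Eventually.of_forall fun ω => ?_)
    simp [hg]
  unfold regret
  rw [integral_finsetSum _ fun n _ => hLi n, Finset.mul_sum, ← Finset.sum_sub_distrib]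
  refine Finset.sum_congr rfl fun n _ => ?_
  rw [hLX n, hLg n, Finset.mul_sum, ← Finset.sum_sub_distrib]
  exact Finset.sum_congr rfl fun j _ => by ring

/-! ### Growth estimates and summability -/

/-- Halving the time lowers the logarithm only by `log 2`, so the ratio of logarithms tends to 1. -/
theorem eventually_sq_mul_log_le {θ : ℝ} (hθ : 0 ≤ θ) (hθ1 : θ < 1) :
    ∀ᶠ n : ℕ in Filter.atTop, ∀ i : ℕ, (n + 1) / 2 ≤ i →
      θ ^ 2 * Real.log (n + 1) ≤ Real.log (i + 1) := by
  have htend : Filter.Tendsto (fun n : ℕ => Real.log ((n : ℝ) + 1)) Filter.atTop Filter.atTop :=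
    Real.tendsto_log_atTop.comp
      (Filter.tendsto_atTop_add_const_right _ 1 tendsto_natCast_atTop_atTop)
  have h1 : 0 < 1 - θ ^ 2 := by nlinarith
  filter_upwards [htend.eventually_ge_atTop (Real.log 2 / (1 - θ ^ 2))] with n hn i hi
  rw [div_le_iff₀ h1] at hn
  have hle : ((n : ℝ) + 1) / 2 ≤ i + 1 := by
    have : n + 1 ≤ 2 * (i + 1) := by omega
    have : (n : ℝ) + 1 ≤ 2 * (i + 1) := by exact_mod_cast this
    linarith
  have := Real.log_le_log (by positivity) hle
  rw [Real.log_div (by positivity) (by norm_num)] at this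
  linarith

theorem eventually_log_le_half (A B : ℝ) {ρ : ℝ} (hρ : 0 < ρ) :
    ∀ᶠ n : ℕ in Filter.atTop, A * Real.log (n + 1) + B < ρ * (n / 2 : ℕ) / 2 := by
  have hlin : Filter.Tendsto (fun n : ℕ => (n : ℝ) + 1) Filter.atTop Filter.atTop :=
    Filter.tendsto_atTop_add_const_right _ 1 tendsto_natCast_atTop_atTop
  have hc : 0 < ρ / (8 * (|A| + 1)) := by positivity
  have hlog := (Real.isLittleO_log_id_atTop.comp_tendsto hlin).def hc
  filter_upwards [hlog, hlin.eventually_gt_atTop ((B + ρ / 2) / (ρ / 8))] with n h1 h2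
  simp only [Function.comp_apply, id, Real.norm_eq_abs] at h1
  have hn : (0 : ℝ) ≤ n := Nat.cast_nonneg n
  rw [abs_of_nonneg (Real.log_nonneg (by linarith)),
    abs_of_nonneg (by linarith : (0 : ℝ) ≤ (n : ℝ) + 1)] at h1
  rw [div_lt_iff₀ (by positivity)] at h2
  have h3 : A * Real.log (n + 1) ≤ ρ / 8 * (n + 1) := by
    have hl : 0 ≤ Real.log ((n : ℝ) + 1) := Real.log_nonneg (by linarith)
    calc A * Real.log (n + 1) ≤ (|A| + 1) * Real.log (n + 1) := by
          gcongr; linarith [le_abs_self A]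
      _ ≤ (|A| + 1) * (ρ / (8 * (|A| + 1)) * (n + 1)) := by gcongr
      _ = _ := by field_simp
  have h4 : ((n : ℝ) + 1) / 2 - 1 ≤ (n / 2 : ℕ) := by
    have : n ≤ 2 * (n / 2) + 1 := by omega
    have : (n : ℝ) ≤ 2 * (n / 2 : ℕ) + 1 := by exact_mod_cast this
    linarith
  nlinarith

/-- Bound on the probability that a suboptimal arm is pulled at high load in slot `n + 1`. -/
noncomputable def failureBound (K : ℕ) (α η ρ : ℝ) (n : ℕ) : ℝ :=
  K * (2 * (α / η ^ 2 * Real.log (n + 1)) * Real.exp (-(32 / 25) * Real.log (n + 1)) +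
    2 * n * Real.exp (-3 * Real.log (n + 1))) +
  Real.exp (ρ ^ 2 / 4) * Real.exp (-(ρ ^ 2 / 4)) ^ n

theorem failureBound_nonneg (K : ℕ) {α : ℝ} (hα : 0 ≤ α) (η ρ : ℝ) (n : ℕ) :
    0 ≤ failureBound K α η ρ n := by
  have : 0 ≤ Real.log ((n : ℝ) + 1) :=
    Real.log_nonneg (by linarith [(Nat.cast_nonneg n : (0 : ℝ) ≤ n)])
  unfold failureBound
  positivity

theorem summable_failureBound (K : ℕ) (α η : ℝ) {ρ : ℝ} (hρ : 0 < ρ) :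
    Summable (failureBound K α η ρ) := by
  have hexp : ∀ (s : ℝ) (n : ℕ), Real.exp (s * Real.log (n + 1)) = ((n + 1 : ℕ) : ℝ) ^ s := by
    intro s n
    rw [Real.rpow_def_of_pos (by positivity), mul_comm]
    push_cast
    rfl
  have hpow : ∀ s : ℝ, s < -1 → Summable fun n : ℕ => ((n + 1 : ℕ) : ℝ) ^ s := fun s hs =>
    (summable_nat_add_iff 1).2 (Real.summable_nat_rpow.2 hs)
  have h1 : Summable fun n : ℕ =>
      Real.log (n + 1) * Real.exp (-(32 / 25) * Real.log (n + 1)) := by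
    refine Summable.of_nonneg_of_le (fun n => ?_) (fun n => ?_)
      -- The logarithm is absorbed by `log x ≤ 25 * x ^ (1/25)`, leaving an exponent still below -1.
      ((hpow (-(31 / 25)) (by norm_num)).mul_left 25)
    · have : 0 ≤ Real.log ((n : ℝ) + 1) :=
        Real.log_nonneg (by linarith [(Nat.cast_nonneg n : (0 : ℝ) ≤ n)])
      positivity
    · have hx : (0 : ℝ) < ((n + 1 : ℕ) : ℝ) := by positivity
      have hl := Real.log_le_rpow_div hx.le (ε := 1 / 25) (by norm_num)
      rw [hexp]
      calc Real.log (n + 1) * ((n + 1 : ℕ) : ℝ) ^ (-(32 / 25) : ℝ)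
          ≤ ((n + 1 : ℕ) : ℝ) ^ (1 / 25 : ℝ) / (1 / 25) * ((n + 1 : ℕ) : ℝ) ^ (-(32 / 25) : ℝ) := by
            refine mul_le_mul_of_nonneg_right ?_ (Real.rpow_nonneg hx.le _)
            simpa using hl
        _ = 25 * (((n + 1 : ℕ) : ℝ) ^ (1 / 25 : ℝ) * ((n + 1 : ℕ) : ℝ) ^ (-(32 / 25) : ℝ)) := by
            ring
        _ = 25 * ((n + 1 : ℕ) : ℝ) ^ (-(31 / 25) : ℝ) := by
            rw [← Real.rpow_add hx]; norm_num
  have h2 : Summable fun n : ℕ => (n : ℝ) * Real.exp (-3 * Real.log (n + 1)) := by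
    refine Summable.of_nonneg_of_le (fun n => by positivity) (fun n => ?_)
      (hpow (-2) (by norm_num))
    have hx : (0 : ℝ) < ((n + 1 : ℕ) : ℝ) := by positivity
    rw [hexp]
    calc (n : ℝ) * ((n + 1 : ℕ) : ℝ) ^ (-3 : ℝ)
        ≤ ((n + 1 : ℕ) : ℝ) ^ (1 : ℝ) * ((n + 1 : ℕ) : ℝ) ^ (-3 : ℝ) := by
          refine mul_le_mul_of_nonneg_right ?_ (Real.rpow_nonneg hx.le _)
          simp
      _ = _ := by rw [← Real.rpow_add hx]; norm_num
  have h3 : Summable fun n : ℕ => Real.exp (-(ρ ^ 2 / 4)) ^ n :=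
    summable_geometric_of_lt_one (Real.exp_nonneg _) (Real.exp_lt_one_iff.2 (by
      have := pow_pos hρ 2
      linarith))
  refine ((((h1.mul_left (2 * (α / η ^ 2))).add (h2.mul_left 2)).mul_left (K : ℝ)).add
    (h3.mul_left (Real.exp (ρ ^ 2 / 4)))).congr fun n => ?_
  unfold failureBound
  ring

/-! ### From one slot to the total regret -/

theorem IsAdaUCB.le_index_action {K : ℕ} {α lo hi : ℝ} {Γ : Policy K} (h : IsAdaUCB α lo hi Γ)
    (l : ℕ → ℝ) (x : Fin K → ℕ → ℝ) {n : ℕ} (hn : K ≤ n) (j : Fin K) :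
    armSum (action Γ l x) x j n / armCount (action Γ l x) j n +
      √(α * (1 - normLoad lo hi (l n)) * Real.log (n + 1) / armCount (action Γ l x) j n) ≤
    armSum (action Γ l x) x (action Γ l x n) n / armCount (action Γ l x) (action Γ l x n) n +
      √(α * (1 - normLoad lo hi (l n)) * Real.log (n + 1) /
        armCount (action Γ l x) (action Γ l x n) n) := by
  have := h.argmax n hn (l n) (history Γ l x n) j
  simp only [adaIndex, pulls_history, empMean_history] at this
  exact this

theorem IsRandomBinaryBandit.measureReal_suboptimal_le {K : ℕ} {Ω : Type*}
    [MeasurableSpace Ω] {P : Measure Ω} [IsProbabilityMeasure P] {α ε₁ ρ η θ gap : ℝ}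
    {u : Fin K → ℝ} {kstar : Fin K} {L : ℕ → Ω → ℝ} {X : Fin K → ℕ → Ω → ℝ} {Γ : Policy K}
    (h : IsRandomBinaryBandit P 0 ε₁ ρ u L X) (hΓ : IsAdaUCB α 0 1 Γ)
    (hα : 16 ≤ α) (hε0 : 0 ≤ ε₁) (hε1 : ε₁ ≤ 1) (hρ : 0 < ρ)
    (hη : 0 < η) (hθ : θ ≤ 1) (hgap : ∀ k, k ≠ kstar → gap ≤ u kstar - u k)
    (hθε : 1 / 5 + √ε₁ < θ - 1 / 5) (hηg : 3 * η < (θ - 1 / 5 - (1 / 5 + √ε₁)) * gap)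
    {n : ℕ} (hK : K ≤ (n + 1) / 2)
    (hcount : K * (α / η ^ 2) * Real.log (n + 1) + K < ρ * (n / 2 : ℕ) / 2)
    (hlog : ∀ i : ℕ, (n + 1) / 2 ≤ i → θ ^ 2 * Real.log (n + 1) ≤ Real.log (i + 1)) :
    P.real {ω | L n ω ≠ 0 ∧ action Γ (fun i => L i ω) (fun k i => X k i ω) n ≠ kstar} ≤
      failureBound K α η ρ n := by
  have hT : 0 ≤ Real.log ((n : ℝ) + 1) :=
    Real.log_nonneg (by linarith [(Nat.cast_nonneg n : (0 : ℝ) ≤ n)])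
  have hbad := h.measureReal_inaccurate_le hΓ.measurable hα hη hT n
  have hload := h.measureReal_card_load_le hρ.le (Finset.Ico ((n + 1) / 2) n)
  have hcard : (Finset.Ico ((n + 1) / 2) n).card = n / 2 := by rw [Nat.card_Ico]; omega
  rw [hcard] at hload
  set E₁ : Set Ω := {ω | ∃ i ≤ n, ∃ j,
      0 < armCount (action Γ (fun i => L i ω) (fun k i => X k i ω)) j i ∧
      accuracy α η (Real.log (n + 1))
        (armCount (action Γ (fun i => L i ω) (fun k i => X k i ω)) j i) <
        |armSum (action Γ (fun i => L i ω) (fun k i => X k i ω)) (fun k i => X k i ω) j i /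
          armCount (action Γ (fun i => L i ω) (fun k i => X k i ω)) j i - u j|} with hE₁
  set E₂ : Set Ω := {ω | (((Finset.Ico ((n + 1) / 2) n).filter fun i => L i ω = 0).card : ℝ) ≤
      ρ * (n / 2 : ℕ) / 2} with hE₂
  -- Rounding in `n / 2` loses at most one half, whence the factor `Real.exp (ρ ^ 2 / 4)`.
  have hexp : Real.exp (-(ρ ^ 2 * (n / 2 : ℕ) / 2)) ≤
      Real.exp (ρ ^ 2 / 4) * Real.exp (-(ρ ^ 2 / 4)) ^ n := by
    rw [← Real.exp_nat_mul, ← Real.exp_add, Real.exp_le_exp]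
    have : n ≤ 2 * (n / 2) + 1 := by omega
    have : (n : ℝ) ≤ 2 * (n / 2 : ℕ) + 1 := by exact_mod_cast this
    nlinarith [sq_nonneg ρ]
  have hsub : ({ω | L n ω ≠ 0 ∧ action Γ (fun i => L i ω) (fun k i => X k i ω) n ≠ kstar} :
      Set Ω) ≤ᵐ[P] (E₁ ∪ E₂ : Set Ω) := by
    filter_upwards [h.load_mem n] with ω hLω hω
    obtain ⟨hL0, hane⟩ := hω
    have hL1 := hLω.resolve_left hL0
    by_contra hnot
    have hnot₁ : ω ∉ E₁ := fun hh => hnot (Or.inl hh)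
    have hnot₂ : ω ∉ E₂ := fun hh => hnot (Or.inr hh)
    simp only [hE₁, Set.mem_ofPred_eq, not_exists, not_and, not_lt] at hnot₁
    simp only [hE₂, Set.mem_ofPred_eq, not_le] at hnot₂
    refine hane (eq_best_of_accurate (n := n) (l := fun i => L i ω) (x := fun k i => X k i ω)
      (u := u) (kstar := kstar) (α := α) (ε₁ := ε₁) (η := η) (θ := θ) (gap := gap)
      (by linarith) hε0 hε1 hη hθ hgap hθε hηg ?_ ?_ ?_ hnot₁ ?_ hK hlog)
    · intro i hi j
      refine armCount_pos_of_init (fun r hr => ?_) hi j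
      rw [← pulls_history]
      exact hΓ.init r hr _ _
    · intro i hKi _ hLi j
      have := hΓ.le_index_action (fun i => L i ω) (fun k i => X k i ω) hKi j
      have e : normLoad 0 1 (L i ω) = 0 := by simp [normLoad, hLi]
      simpa only [e, sub_zero, mul_one] using this
    · intro j
      have hKn : K ≤ n := hK.trans (by
        have := j.2
        omega)
      have := hΓ.le_index_action (fun i => L i ω) (fun k i => X k i ω) hKn j
      -- The thresholds 0 and 1 leave a high load `1 - ε₁` unchanged, so its bonus shrinks by
      -- exactly `√ε₁`.
      have e : 1 - normLoad 0 1 (L n ω) = ε₁ := by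
        rw [hL1]
        simp [normLoad, hε0, hε1]
      simpa only [e] using this
    · refine lt_trans ?_ hnot₂
      linarith
  calc _ ≤ P.real (E₁ ∪ E₂) :=
        ENNReal.toReal_mono (measure_ne_top _ _) (measure_mono_ae hsub)
    _ ≤ P.real E₁ + P.real E₂ := measureReal_union_le _ _
    _ ≤ _ := add_le_add hbad (hload.trans hexp)

end OppBandit

theorem corollary1 {K : ℕ} (α ε₁ ρ : ℝ) (u : Fin K → ℝ) (kstar : Fin K)
    (hbest : ∀ k, k ≠ kstar → u k < u kstar)
    (hα : 16 < α) (hε₁ : 0 ≤ ε₁) (hε₁' : ε₁ < √2 / 4)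
    (hρ : 0 < ρ) (hρ' : ρ < 1) :
    ∃ C : ℝ, ∀ (Ω : Type*) [MeasurableSpace Ω] (P : MeasureTheory.Measure Ω)
      [MeasureTheory.IsProbabilityMeasure P]
      (L : ℕ → Ω → ℝ) (X : Fin K → ℕ → Ω → ℝ) (Γ : OppBandit.Policy K),
      OppBandit.IsRandomBinaryBandit P 0 ε₁ ρ u L X →
      OppBandit.IsAdaUCB α 0 1 Γ →
      ∀ T : ℕ, |OppBandit.regret P u L X Γ T| ≤ C := by
  have hsup : ⨆ k, u k = u kstar := by
    refine le_antisymm ?_ (le_ciSup (Set.finite_range u).bddAbove kstar)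
    have : Nonempty (Fin K) := ⟨kstar⟩
    refine ciSup_le fun k => ?_
    by_cases hk : k = kstar
    · rw [hk]
    · exact (hbest k hk).le
  obtain ⟨gap, hgap0, hgap⟩ : ∃ gap : ℝ, 0 < gap ∧ ∀ k, k ≠ kstar → gap ≤ u kstar - u k := by
    rcases (Finset.univ.erase kstar).eq_empty_or_nonempty with he | hne
    · refine ⟨1, one_pos, fun k hk => ?_⟩
      have : k ∈ Finset.univ.erase kstar := Finset.mem_erase.2 ⟨hk, Finset.mem_univ k⟩
      simp [he] at this
    · obtain ⟨k₀, hk₀, hmin⟩ := Finset.exists_min_image _ (fun k => u kstar - u k) hne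
      exact ⟨u kstar - u k₀, sub_pos.2 (hbest k₀ (Finset.mem_erase.1 hk₀).1),
        fun k hk => hmin k (Finset.mem_erase.2 ⟨hk, Finset.mem_univ k⟩)⟩
  -- `√2 / 4` is just below `9 / 25 = (3 / 5) ^ 2`, so `1/5 + √ε₁ < 1 - 1/5`.
  have hs2 : √2 < 36 / 25 := by
    rw [Real.sqrt_lt' (by norm_num)]
    norm_num
  have hsε : √ε₁ < 3 / 5 := by
    rw [Real.sqrt_lt' (by norm_num)]
    linarith
  have hsε0 := Real.sqrt_nonneg ε₁
  -- `θ` is the midpoint between `√ε₁ + 2/5` and 1; `η` uses a quarter of the slack, since the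
  -- argument needs strictly less than a third.
  set θ : ℝ := (√ε₁ + 7 / 5) / 2 with hθ
  set η : ℝ := (θ - 1 / 5 - (1 / 5 + √ε₁)) * gap / 4 with hη
  have hθε : 1 / 5 + √ε₁ < θ - 1 / 5 := by rw [hθ]; linarith
  have hη0 : 0 < η := by
    have := mul_pos (sub_pos.2 hθε) hgap0
    rw [hη]; linarith
  obtain ⟨n₀, hn₀⟩ := Filter.eventually_atTop.1 ((Filter.eventually_ge_atTop (2 * K)).and
    ((OppBandit.eventually_log_le_half (K * (α / η ^ 2)) K hρ).and
      (OppBandit.eventually_sq_mul_log_le (θ := θ) (by rw [hθ]; linarith)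
        (by rw [hθ]; linarith))))
  -- The first `n₀` slots are bounded trivially by 1. Since `n₀` and `G` are fixed before the
  -- probability space and the policy, the constant is uniform in them.
  set G : ℕ → ℝ := fun n => (if n < n₀ then 1 else 0) + OppBandit.failureBound K α η ρ n with hG
  have hG0 : ∀ n, 0 ≤ G n := fun n =>
    add_nonneg (by split_ifs <;> norm_num) (OppBandit.failureBound_nonneg K (by linarith) η ρ n)
  have hGs : Summable G := by
    refine Summable.add ?_ (OppBandit.summable_failureBound K α η hρ)
    refine summable_of_ne_finset_zero (s := Finset.range n₀) fun n hn => ?_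
    simpa using hn
  refine ⟨(∑ j, (u kstar - u j)) * ∑' n, G n, ?_⟩
  intro Ω _ P _ L X Γ h hΓ T
  have hgap_nonneg : ∀ j, 0 ≤ u kstar - u j := by
    intro j
    by_cases hj : j = kstar
    · rw [hj, sub_self]
    · exact (sub_pos.2 (hbest j hj)).le
  have hslot : ∀ n, P.real {ω | L n ω ≠ 0 ∧
      OppBandit.action Γ (fun i => L i ω) (fun k i => X k i ω) n ≠ kstar} ≤ G n := by
    intro n
    by_cases hn : n < n₀
    · have := OppBandit.failureBound_nonneg K (by linarith : 0 ≤ α) η ρ n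
      refine measureReal_le_one.trans ?_
      simp only [hG, if_pos hn]
      linarith
    · obtain ⟨h1, h2, h3⟩ := hn₀ n (not_lt.1 hn)
      have := h.measureReal_suboptimal_le hΓ hα.le hε₁ (by linarith) hρ hη0
        (by rw [hθ]; linarith) hgap hθε (by rw [hη]; linarith) (by omega) h2 h3
      simpa only [hG, if_neg hn, zero_add] using this
  have hterm : ∀ n j, |(u kstar - u j) * ∫ ω, (if OppBandit.action Γ (fun i => L i ω)
      (fun k i => X k i ω) n = j then L n ω else 0) ∂P| ≤ (u kstar - u j) * G n := by
    intro n j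
    by_cases hj : j = kstar
    · simp [hj]
    · rw [abs_mul, abs_of_nonneg (hgap_nonneg j)]
      refine mul_le_mul_of_nonneg_left (le_trans ?_ (hslot n)) (hgap_nonneg j)
      have ham : Measurable fun ω =>
          OppBandit.action Γ (fun i => L i ω) (fun k i => X k i ω) n :=
        OppBandit.measurable_action hΓ.measurable n h.load_measurable
          fun k i _ => h.reward_measurable k i
      have hms : MeasurableSet {ω | L n ω ≠ 0 ∧
          OppBandit.action Γ (fun i => L i ω) (fun k i => X k i ω) n ≠ kstar} :=
        MeasurableSet.inter (h.load_measurable n (measurableSet_singleton 0)).compl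
          (ham (measurableSet_singleton kstar)).compl
      rw [← integral_indicator_one hms, ← Real.norm_eq_abs]
      refine norm_integral_le_of_norm_le ((integrable_const (1 : ℝ)).indicator hms) ?_
      filter_upwards [h.load_mem n] with ω hω
      rw [Set.indicator_apply]
      rcases hω with hω | hω
      · simp [hω]
      · split_ifs with h1 h2 h2
        · rw [hω, Real.norm_eq_abs, abs_of_nonneg (by linarith)]
          simp only [Pi.one_apply]
          linarith
        · have : L n ω = 0 := by
            by_contra h0
            exact h2 ⟨h0, by rw [h1]; exact hj⟩
          simp [this]
        · simp
        · simp
  rw [h.regret_eq hΓ.measurable, hsup]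
  calc _ ≤ ∑ n ∈ Finset.range T, ∑ j, (u kstar - u j) * G n :=
        (Finset.abs_sum_le_sum_abs _ _).trans (Finset.sum_le_sum fun n _ =>
          (Finset.abs_sum_le_sum_abs _ _).trans (Finset.sum_le_sum fun j _ => hterm n j))
    _ = (∑ j, (u kstar - u j)) * ∑ n ∈ Finset.range T, G n := by
        rw [Finset.mul_sum]
        exact Finset.sum_congr rfl fun n _ => (Finset.sum_mul _ _ _).symm
    _ ≤ _ := mul_le_mul_of_nonneg_left (hGs.sum_le_tsum _ fun n _ => hG0 n)
        (Finset.sum_nonneg fun j _ => hgap_nonneg j)
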